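/- Let $0<q<1$ and $\alpha>-1$. For $n\in\mathbb N_0$ put $(a;q)_n=\prod_{k=0}^{n-1}(1-aq^k)$, $(a;q)_\infty=\prod_{k\ge 0}(1-aq^k)$ and $[n]_q!=\prod_{k=1}^n\frac{1-q^k}{1-q}$. Let $$\exp_q(z)=\sum_{n=0}^\infty \frac{q^{n(n-1)/4}}{(q;q)_n}\,(z(1-q))^n\qquad(z\in\mathbb C)$$ be Exton's $q$-exponential function, and let $$C_q(z)=\tfrac12\big(\exp_q(iz)+\exp_q(-iz)\big),\qquad S_q(z)=\tfrac1{2i}\big(\exp_q(iz)-\exp_q(-iz)\big).$$ For $0<p<1$ let $$J^{(3)}_\alpha(z;p)=\frac{(p^{\alpha+1};p)_\infty}{(p;p)_\infty}\sum_{n=0}^\infty(-1)^n\frac{p^{n(n+1)/2}z^{2n+\alpha}}{(p;p)_n(p^{\alpha+1};p)_n},\qquad \mathcal J^{(3)}_\alpha(z;p)=\frac{(p;p)_\infty}{(p^{\alpha+1};p)_\infty}\,z^{-\alpha}J^{(3)}_\alpha(z;p),$$ where $\mathcal J^{(3)}_\alpha(\cdot;p)$ is regarded as an entire function. Let $j^{(3)}_{1,\alpha}$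 be the smallest positive zero of $J^{(3)}_\alpha(\cdot;q^2)$, and put $$\eta_{\alpha,1}=\frac{q^{1/4}j^{(3)}_{1,\alpha}}{1-q},\qquad g^{(3)}_\alpha(t;q)=\mathcal J^{(3)}_\alpha\big(\tfrac t2(1-q)q^{-1/4};q^2\big).$$ Define $B^{(3)}_{n,\alpha}(z;q)$ as $[n]_q!$ times the $n$-th Taylor coefficient at $t=0$ of the generating function $$\frac{\exp_q(zt)\exp_q(-t/2)}{g^{(3)}_\alpha(it;q)}=\sum_{n=0}^\infty B^{(3)}_{n,\alpha}(z;q)\frac{t^n}{[n]_q!}.$$ Then the smallest positive zero $j^{(3)}_{1,\alpha}$ exists, $D:=\frac{d}{dz}\mathcal J^{(3)}_\alpha(z;q^2)\big|_{z=j^{(3)}_{1,\alpha}}\ne0$, and for every $z\in\mathbb C$ and every real $r$ with $0<r\le 2\eta_{\alpha,1}$, as $n\to\infty$, $$B^{(3)}_{2n,\alpha}(z;q)=\frac{4q^{1/4}}{1-q}\,\frac{(-1)^{n+1}[2n]_q!\,\big(C_q(2\eta_{\alpha,1}z)C_q(\eta_{\alpha,1})+S_q(2\eta_{\alpha,1}z)S_q(\eta_{\alpha,1})\big)}{(2\eta_{\alpha,1})^{2n+1}\,D}+[2n]_q!\;o(r^{-2n}),$$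 $$B^{(3)}_{2n+1,\alpha}(z;q)=\frac{4q^{1/4}}{1-q}\,\frac{(-1)^{n+1}[2n+1]_q!\,\big(S_q(2\eta_{\alpha,1}z)C_q(\eta_{\alpha,1})-C_q(2\eta_{\alpha,1}z)S_q(\eta_{\alpha,1})\big)}{(2\eta_{\alpha,1})^{2n+2}\,D}+[2n+1]_q!\;o(r^{-2n}).$$ -/

import Mathlib

noncomputable section

namespace QBern

open Complex

/-- The finite `q`-shifted factorial `(a; q)_n = ∏_{k < n} (1 - a q^k)`. -/
def qShift (a q : ℝ) (n : ℕ) : ℝ := ∏ k ∈ Finset.range n, (1 - a * q ^ k)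

/-- The infinite `q`-shifted factorial `(a; q)_∞ = ∏_{k ≥ 0} (1 - a q^k)`. -/
def qShiftInf (a q : ℝ) : ℝ := ∏' k : ℕ, (1 - a * q ^ k)

/-- The `q`-factorial `[n]_q! = ∏_{k = 1}^{n} (1 - q^k) / (1 - q)`. -/
def qFact (q : ℝ) (n : ℕ) : ℝ := ∏ k ∈ Finset.range n, (1 - q ^ (k + 1)) / (1 - q)

/-- Exton's `q`-exponential function
`exp_q(z) = ∑ q^{n(n-1)/4} (z(1-q))^n / (q;q)_n`. -/
def qExp (q : ℝ) (z : ℂ) : ℂ :=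
  ∑' n : ℕ, (((q ^ ((n : ℝ) * ((n : ℝ) - 1) / 4) / qShift q q n : ℝ)) : ℂ) * (z * (1 - (q : ℂ))) ^ n

/-- The `q`-cosine attached to `exp_q`: the even part of `z ↦ exp_q(iz)`. -/
def qCos (q : ℝ) (z : ℂ) : ℂ := (qExp q (I * z) + qExp q (-(I * z))) / 2

/-- The `q`-sine attached to `exp_q`: the odd part of `z ↦ exp_q(iz)`, divided by `i`. -/
def qSin (q : ℝ) (z : ℂ) : ℂ := (qExp q (I * z) - qExp q (-(I * z))) / (2 * I)

/-- The third Jackson (Hahn-Exton) `q`-Bessel function `J_α^{(3)}(z; p)`, with the principal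
branch of `z^{2n+α}`. -/
def besselJ (α p : ℝ) (z : ℂ) : ℂ :=
  ((qShiftInf (p ^ (α + 1)) p / qShiftInf p p : ℝ) : ℂ) *
    ∑' n : ℕ, (-1 : ℂ) ^ n * ((p ^ (n * (n + 1) / 2) : ℝ) : ℂ) * z ^ ((2 * n + α : ℝ) : ℂ) /
      ((qShift p p n * qShift (p ^ (α + 1)) p n : ℝ) : ℂ)

/-- The modified function `𝒥_α^{(3)}(z; p) = (p;p)_∞ / (p^{α+1};p)_∞ * z^{-α} J_α^{(3)}(z; p)`,
as an entire function of `z`; see `besselModJ_eq`. -/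
def besselModJ (α p : ℝ) (z : ℂ) : ℂ :=
  ∑' n : ℕ, (-1 : ℂ) ^ n * ((p ^ (n * (n + 1) / 2) : ℝ) : ℂ) * z ^ (2 * n) /
    ((qShift p p n * qShift (p ^ (α + 1)) p n : ℝ) : ℂ)

theorem qShiftInf_ne_zero {a p : ℝ} (ha0 : 0 < a) (ha1 : a < 1) (hp0 : 0 < p) (hp1 : p < 1) :
    qShiftInf a p ≠ 0 := by
  have h : ∏' k : ℕ, (1 + (-(a * p ^ k))) ≠ 0 := by
    apply tprod_one_add_ne_zero_of_summable
    · intro k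
      have h1 : p ^ k ≤ 1 := pow_le_one₀ hp0.le hp1.le
      have h2 : 0 < p ^ k := by positivity
      nlinarith
    · have h3 := (summable_geometric_of_lt_one hp0.le hp1).mul_left a
      refine h3.congr fun k => ?_
      rw [norm_neg, Real.norm_of_nonneg (by positivity)]
  simpa [qShiftInf, sub_eq_add_neg] using h

/-- The modified function is the stated normalization of the `q`-Bessel function. -/
theorem besselModJ_eq {α p : ℝ} (hα : -1 < α) (hp0 : 0 < p) (hp1 : p < 1) {z : ℂ} (hz : z ≠ 0) :
    besselModJ α p z =
      ((qShiftInf p p / qShiftInf (p ^ (α + 1)) p : ℝ) : ℂ) * z ^ (-(α : ℂ)) * besselJ α p z := by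
  have h1 : qShiftInf p p ≠ 0 := qShiftInf_ne_zero hp0 hp1 hp0 hp1
  have h2 : qShiftInf (p ^ (α + 1)) p ≠ 0 :=
    qShiftInf_ne_zero (Real.rpow_pos_of_pos hp0 _)
      (Real.rpow_lt_one hp0.le hp1 (by linarith)) hp0 hp1
  have h3 : ((qShiftInf p p / qShiftInf (p ^ (α + 1)) p : ℝ) : ℂ) *
      ((qShiftInf (p ^ (α + 1)) p / qShiftInf p p : ℝ) : ℂ) = 1 := by
    rw [← Complex.ofReal_mul]
    have : qShiftInf p p / qShiftInf (p ^ (α + 1)) p *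
      (qShiftInf (p ^ (α + 1)) p / qShiftInf p p) = 1 := by field_simp
    rw [this, Complex.ofReal_one]
  have h4 : z ^ (-(α : ℂ)) * ∑' n : ℕ,
      (-1 : ℂ) ^ n * ((p ^ (n * (n + 1) / 2) : ℝ) : ℂ) * z ^ ((2 * n + α : ℝ) : ℂ) /
        ((qShift p p n * qShift (p ^ (α + 1)) p n : ℝ) : ℂ) = besselModJ α p z := by
    rw [← tsum_mul_left, besselModJ]
    refine tsum_congr fun n => ?_
    have h5 : z ^ (-(α : ℂ)) * z ^ ((2 * n + α : ℝ) : ℂ) = z ^ (2 * n) := by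
      rw [← Complex.cpow_add _ _ hz, ← Complex.cpow_natCast]
      congr 1
      push_cast
      ring
    rw [← h5]
    ring
  rw [besselJ, ← h4]
  linear_combination (-(z ^ (-(α : ℂ)) * ∑' n : ℕ,
      (-1 : ℂ) ^ n * ((p ^ (n * (n + 1) / 2) : ℝ) : ℂ) * z ^ ((2 * n + α : ℝ) : ℂ) /
        ((qShift p p n * qShift (p ^ (α + 1)) p n : ℝ) : ℂ))) * h3

/-- The first positive zero `j_{1,α}^{(3)}` of `J_α^{(3)}(·; q²)`. -/
def besselZero (α q : ℝ) : ℝ := sInf {x : ℝ | 0 < x ∧ besselJ α (q ^ 2) (x : ℂ) = 0}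

/-- `η_{α,1} = q^{1/4} j_{1,α}^{(3)} / (1 - q)`. -/
def eta (α q : ℝ) : ℝ := q ^ (1 / 4 : ℝ) * besselZero α q / (1 - q)

/-- `g_α^{(3)}(t; q) = 𝒥_α^{(3)}((t/2) (1-q) q^{-1/4}; q²)`. -/
def gBessel (α q : ℝ) (t : ℂ) : ℂ :=
  besselModJ α (q ^ 2) (t / 2 * (1 - (q : ℂ)) * ((q ^ (-(1 / 4) : ℝ) : ℝ) : ℂ))

/-- The generating function `exp_q(zt) exp_q(-t/2) / g_α^{(3)}(it; q)`. -/
def genFun (α q : ℝ) (z t : ℂ) : ℂ :=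
  qExp q (z * t) * qExp q (-t / 2) / gBessel α q (I * t)

/-- The generalized `q`-Bernoulli polynomial `B_{n,α}^{(3)}(z; q)`: `[n]_q!` times the `n`-th Taylor
coefficient at `t = 0` of the generating function, so that
`exp_q(zt) exp_q(-t/2) / g_α^{(3)}(it; q) = ∑ B_{n,α}^{(3)}(z; q) t^n / [n]_q!`. -/
def qBernoulli (α q : ℝ) (n : ℕ) (z : ℂ) : ℂ :=
  (qFact q n : ℂ) * (iteratedDeriv n (genFun α q z) 0 / (n.factorial : ℂ))

end QBern

end

noncomputable section

namespace QBern

open Complex Filter Topology Asymptotics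

/-! With `p = q²`, `b = p^(α+1)`, `c = (1-q)q^(-1/4)`, `j` the first zero and `F = hahnExton b p`,
the modified Bessel function is `F(z²)`, and the denominator of the generating function is
`F(-c²t²/4)`. The asymptotics follow by Darboux's method: the only singularities in the closed disc
`|t| ≤ 2η` are simple poles at `±2iη`. Their principal parts give the main terms, and the remainder
is holomorphic in a larger disc, so its coefficients are `O(ρ^(-n))` for some `ρ > 2η`. This strict
inequality is why `r = 2η` is allowed.

The substance is that `j²` is the only zero of `F` in `|x| ≤ j²`, and that it is simple. Both rest
on the `p`-difference equation `hahnExton_difference`. The Casoratian of the solutions attached to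
`x` and its conjugate telescopes to a sum of nonnegative terms, which must vanish if `F x = 0` with
`x` non-real; `eq_zero_of_casoratian` excludes this. Using the `x`-derivative as second solution
excludes double zeros. Positivity of the series on `x ≤ 0` leaves only positive zeros, and the
difference equation forces one to exist. -/

/-! ### Entire power series and the `q`-exponential. -/

/-- A power series whose consecutive coefficients have ratios tending to zero converges absolutely
everywhere. -/
theorem summable_of_ratio_tendsto_zero {a : ℕ → ℂ} (ha : ∀ n, a n ≠ 0)
    (h : Tendsto (fun n => ‖a (n + 1)‖ / ‖a n‖) atTop (𝓝 0)) (z : ℂ) :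
    Summable fun n => a n * z ^ n := by
  rcases eq_or_ne z 0 with rfl | hz
  · refine summable_of_ne_finset_zero (s := {0}) fun n hn => ?_
    simp only [Finset.mem_singleton] at hn
    simp [hn]
  · refine summable_of_ratio_test_tendsto_lt_one (l := 0) one_pos
      (Eventually.of_forall fun n => mul_ne_zero (ha n) (pow_ne_zero n hz)) ?_
    have h2 := h.mul_const ‖z‖
    rw [zero_mul] at h2
    refine h2.congr fun n => ?_
    have h3 : ‖z‖ ≠ 0 := norm_ne_zero_iff.2 hz
    have h4 : ‖a n‖ ≠ 0 := norm_ne_zero_iff.2 (ha n)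
    rw [norm_mul, norm_mul, norm_pow, norm_pow, pow_succ]
    field_simp

/-- A power series whose consecutive coefficients have ratios tending to zero is entire. -/
theorem differentiable_tsum_of_ratio_tendsto_zero {a : ℕ → ℂ} (ha : ∀ n, a n ≠ 0)
    (h : Tendsto (fun n => ‖a (n + 1)‖ / ‖a n‖) atTop (𝓝 0)) :
    Differentiable ℂ fun z : ℂ => ∑' n, a n * z ^ n := by
  have hr := FormalMultilinearSeries.ofScalars_radius_eq_top_of_tendsto (𝕜 := ℂ) ℂ a
    (Eventually.of_forall ha) h
  have h1 := (FormalMultilinearSeries.ofScalars (𝕜 := ℂ) ℂ a).hasFPowerSeriesOnBall (by rw [hr]; simp)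
  rw [hr] at h1
  have h2 : (FormalMultilinearSeries.ofScalars (𝕜 := ℂ) ℂ a).sum = fun z : ℂ => ∑' n, a n * z ^ n := by
    funext z
    exact FormalMultilinearSeries.ofScalars_sum_eq (E := ℂ) a z
  rw [h2] at h1
  have h3 := h1.differentiableOn
  rw [Metric.eball_top] at h3
  exact differentiableOn_univ.1 h3

theorem qShift_succ (a q : ℝ) (n : ℕ) : qShift a q (n + 1) = qShift a q n * (1 - a * q ^ n) := by
  rw [qShift, Finset.prod_range_succ, qShift]

theorem qShift_pos {a q : ℝ} (ha0 : 0 < a) (ha1 : a < 1) (hq0 : 0 < q) (hq1 : q < 1) (n : ℕ) :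
    0 < qShift a q n := by
  refine Finset.prod_pos fun k _ => ?_
  have h1 : q ^ k ≤ 1 := pow_le_one₀ hq0.le hq1.le
  have h2 : 0 < q ^ k := by positivity
  nlinarith

theorem differentiable_qExp {q : ℝ} (hq0 : 0 < q) (hq1 : q < 1) : Differentiable ℂ (qExp q) := by
  have hpos : ∀ n : ℕ, 0 < q ^ ((n : ℝ) * ((n : ℝ) - 1) / 4) / qShift q q n := fun n =>
    div_pos (Real.rpow_pos_of_pos hq0 _) (qShift_pos hq0 hq1 hq0 hq1 n)
  have h := differentiable_tsum_of_ratio_tendsto_zero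
    (a := fun n : ℕ => ((q ^ ((n : ℝ) * ((n : ℝ) - 1) / 4) / qShift q q n : ℝ) : ℂ))
    (fun n => Complex.ofReal_ne_zero.2 (hpos n).ne') ?_
  · exact h.comp (g := fun z : ℂ => ∑' n : ℕ, _) (f := fun z : ℂ => z * (1 - (q : ℂ))) (by fun_prop)
  · have hq2 : q ^ (1 / 2 : ℝ) < 1 := Real.rpow_lt_one hq0.le hq1 (by norm_num)
    -- The ratio of consecutive coefficients: the exponents `n(n-1)/4` increase by `n/2`.
    have h1 : Tendsto (fun n : ℕ => (q ^ (1 / 2 : ℝ)) ^ n / (1 - q * q ^ n)) atTop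
        (𝓝 (0 / (1 - q * 0))) :=
      (tendsto_pow_atTop_nhds_zero_of_lt_one (by positivity) hq2).div
        (((tendsto_pow_atTop_nhds_zero_of_lt_one hq0.le hq1).const_mul q).const_sub 1) (by norm_num)
    rw [zero_div] at h1
    refine h1.congr fun n => ?_
    rw [Complex.norm_real, Complex.norm_real, Real.norm_of_nonneg (hpos _).le,
      Real.norm_of_nonneg (hpos _).le, qShift_succ]
    have h2 : q ^ (((n + 1 : ℕ) : ℝ) * (((n + 1 : ℕ) : ℝ) - 1) / 4) =
        q ^ ((n : ℝ) * ((n : ℝ) - 1) / 4) * (q ^ (1 / 2 : ℝ)) ^ n := by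
      rw [← Real.rpow_natCast, ← Real.rpow_mul hq0.le, ← Real.rpow_add hq0]
      congr 1
      push_cast
      ring
    rw [h2]
    have h3 := (qShift_pos hq0 hq1 hq0 hq1 n).ne'
    have h4 : (1 - q * q ^ n) ≠ 0 := by
      have := (qShift_pos hq0 hq1 hq0 hq1 (n + 1)).ne'
      rw [qShift_succ] at this
      exact right_ne_zero_of_mul this
    have h5 : q ^ ((n : ℝ) * ((n : ℝ) - 1) / 4) ≠ 0 := (Real.rpow_pos_of_pos hq0 _).ne'
    field_simp

/-! ### The series `₁φ₁(0; b; p, p x)` and its difference equation. -/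

/-- The coefficients of the basic hypergeometric series `₁φ₁(0; b; p, p x)`. -/
def hahnExtonCoeff (b p : ℝ) (n : ℕ) : ℝ :=
  (-1) ^ n * p ^ (n * (n + 1) / 2) / (qShift p p n * qShift b p n)

/-- The entire function `₁φ₁(0; b; p, p x)`, for which `𝒥_α^{(3)}(z; p)` is its value at
`b = p^{α+1}` and `x = z²`. -/
def hahnExton (b p : ℝ) (x : ℂ) : ℂ := ∑' n : ℕ, (hahnExtonCoeff b p n : ℂ) * x ^ n

theorem besselModJ_eq_hahnExton (α p : ℝ) (z : ℂ) :
    besselModJ α p z = hahnExton (p ^ (α + 1)) p (z ^ 2) := by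
  refine tsum_congr fun n => ?_
  rw [hahnExtonCoeff, ← pow_mul]
  push_cast
  ring

section HahnExton

variable {b p : ℝ}

theorem hahnExtonCoeff_zero : hahnExtonCoeff b p 0 = 1 := by
  simp [hahnExtonCoeff, qShift]

theorem one_sub_mul_pow_pos (hb0 : 0 < b) (hb1 : b < 1) (hp0 : 0 < p) (hp1 : p < 1) (n : ℕ) :
    0 < 1 - b * p ^ n := by
  have h1 : p ^ n ≤ 1 := pow_le_one₀ hp0.le hp1.le
  have h2 : 0 < p ^ n := by positivity
  nlinarith

theorem hahnExtonCoeff_succ (hb0 : 0 < b) (hb1 : b < 1) (hp0 : 0 < p) (hp1 : p < 1) (n : ℕ) :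
    hahnExtonCoeff b p (n + 1) =
      -(p ^ (n + 1) / ((1 - p * p ^ n) * (1 - b * p ^ n))) * hahnExtonCoeff b p n := by
  have h1 : (n + 1) * (n + 1 + 1) / 2 = n * (n + 1) / 2 + (n + 1) := by
    rw [show (n + 1) * (n + 1 + 1) = n * (n + 1) + 2 * (n + 1) by ring,
      Nat.add_mul_div_left _ _ two_pos]
  have h2 := (one_sub_mul_pow_pos hb0 hb1 hp0 hp1 n).ne'
  have h3 := (one_sub_mul_pow_pos hp0 hp1 hp0 hp1 n).ne'
  have h4 := (qShift_pos hb0 hb1 hp0 hp1 n).ne'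
  have h5 := (qShift_pos hp0 hp1 hp0 hp1 n).ne'
  rw [hahnExtonCoeff, hahnExtonCoeff, h1, qShift_succ, qShift_succ, pow_add p, pow_succ (-1 : ℝ)]
  field_simp

theorem hahnExtonCoeff_ne_zero (hb0 : 0 < b) (hb1 : b < 1) (hp0 : 0 < p) (hp1 : p < 1) (n : ℕ) :
    hahnExtonCoeff b p n ≠ 0 := by
  have h4 := (qShift_pos hb0 hb1 hp0 hp1 n).ne'
  have h5 := (qShift_pos hp0 hp1 hp0 hp1 n).ne'
  exact div_ne_zero (mul_ne_zero (pow_ne_zero _ (by norm_num)) (pow_ne_zero _ hp0.ne'))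
    (mul_ne_zero h5 h4)

theorem tendsto_hahnExtonCoeff_ratio (hb0 : 0 < b) (hb1 : b < 1) (hp0 : 0 < p) (hp1 : p < 1) :
    Tendsto (fun n => ‖(hahnExtonCoeff b p (n + 1) : ℂ)‖ / ‖(hahnExtonCoeff b p n : ℂ)‖) atTop
      (𝓝 0) := by
  have h0 := tendsto_pow_atTop_nhds_zero_of_lt_one hp0.le hp1
  have h1 : Tendsto (fun n : ℕ => p ^ (n + 1) / ((1 - p * p ^ n) * (1 - b * p ^ n))) atTop
      (𝓝 (0 / ((1 - p * 0) * (1 - b * 0)))) :=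
    (h0.comp (tendsto_add_atTop_nat 1)).div (((h0.const_mul p).const_sub 1).mul
      ((h0.const_mul b).const_sub 1)) (by norm_num)
  rw [zero_div] at h1
  refine h1.congr fun n => ?_
  have h2 := one_sub_mul_pow_pos hb0 hb1 hp0 hp1 n
  have h3 := one_sub_mul_pow_pos hp0 hp1 hp0 hp1 n
  rw [hahnExtonCoeff_succ hb0 hb1 hp0 hp1, Complex.norm_real, Complex.norm_real, norm_mul,
    norm_neg, mul_div_cancel_right₀ _ (norm_ne_zero_iff.2 (hahnExtonCoeff_ne_zero hb0 hb1 hp0 hp1 n)),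
    Real.norm_of_nonneg (by positivity)]

theorem summable_hahnExton (hb0 : 0 < b) (hb1 : b < 1) (hp0 : 0 < p) (hp1 : p < 1) (x : ℂ) :
    Summable fun n : ℕ => (hahnExtonCoeff b p n : ℂ) * x ^ n :=
  summable_of_ratio_tendsto_zero
    (fun n => Complex.ofReal_ne_zero.2 (hahnExtonCoeff_ne_zero hb0 hb1 hp0 hp1 n))
    (tendsto_hahnExtonCoeff_ratio hb0 hb1 hp0 hp1) x

theorem differentiable_hahnExton (hb0 : 0 < b) (hb1 : b < 1) (hp0 : 0 < p) (hp1 : p < 1) :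
    Differentiable ℂ (hahnExton b p) :=
  differentiable_tsum_of_ratio_tendsto_zero
    (fun n => Complex.ofReal_ne_zero.2 (hahnExtonCoeff_ne_zero hb0 hb1 hp0 hp1 n))
    (tendsto_hahnExtonCoeff_ratio hb0 hb1 hp0 hp1)

theorem hahnExton_zero : hahnExton b p 0 = 1 := by
  rw [hahnExton, tsum_eq_single 0 fun n hn => by simp [hn]]
  simp [hahnExtonCoeff_zero]

theorem hahnExton_conj (x : ℂ) :
    hahnExton b p ((starRingEnd ℂ) x) = (starRingEnd ℂ) (hahnExton b p x) := by
  rw [hahnExton, hahnExton, Complex.conj_tsum]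
  exact tsum_congr fun n => by simp

theorem hahnExton_ofReal_im (x : ℝ) : (hahnExton b p x).im = 0 := by
  rw [← Complex.conj_eq_iff_im, ← hahnExton_conj, Complex.conj_ofReal]

/-- The second order `p`-difference equation. -/
theorem hahnExton_difference (hb0 : 0 < b) (hb1 : b < 1) (hp0 : 0 < p) (hp1 : p < 1) (x : ℂ) :
    p * hahnExton b p x = (p + b - p ^ 2 * x) * hahnExton b p (p * x) -
      b * hahnExton b p (p ^ 2 * x) := by
  have hs := summable_hahnExton hb0 hb1 hp0 hp1
  have e1 := (((hs x).hasSum.mul_left (p : ℂ)).sub ((hs (p * x)).hasSum.mul_left (p + b : ℂ))).add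
    ((hs (p ^ 2 * x)).hasSum.mul_left (b : ℂ))
  have e2 := (hs (p * x)).hasSum.mul_left (-(p ^ 2 * x) : ℂ)
  have e3 := (hasSum_nat_add_iff' 1).2 e1
  -- The constant terms cancel, `p - (p + b) + b = 0`, so `e3` starts at index one. There the factor
  -- `p - (p+b)p^(n+1) + b p^(2n+2) = p(1 - p^(n+1))(1 - b p^n)` cancels the denominators of the
  -- coefficient recurrence.
  have key : ∀ n : ℕ, -((p : ℂ) ^ 2 * x) * ((hahnExtonCoeff b p n : ℂ) * (p * x) ^ n) =
      p * ((hahnExtonCoeff b p (n + 1) : ℂ) * x ^ (n + 1)) -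
        (p + b) * ((hahnExtonCoeff b p (n + 1) : ℂ) * (p * x) ^ (n + 1)) +
        b * ((hahnExtonCoeff b p (n + 1) : ℂ) * (p ^ 2 * x) ^ (n + 1)) := by
    intro n
    have h2 := (one_sub_mul_pow_pos hb0 hb1 hp0 hp1 n).ne'
    have h3 := (one_sub_mul_pow_pos hp0 hp1 hp0 hp1 n).ne'
    have h6 : hahnExtonCoeff b p (n + 1) * ((1 - p * p ^ n) * (1 - b * p ^ n)) =
        -(p ^ (n + 1) * hahnExtonCoeff b p n) := by
      rw [hahnExtonCoeff_succ hb0 hb1 hp0 hp1]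
      generalize 1 - b * p ^ n = s at h2
      generalize 1 - p * p ^ n = t at h3
      field_simp
    have h7 : (hahnExtonCoeff b p (n + 1) : ℂ) * ((1 - p * p ^ n) * (1 - b * p ^ n)) =
        -(p ^ (n + 1) * hahnExtonCoeff b p n) := by exact_mod_cast h6
    simp only [mul_pow, ← pow_mul]
    rw [show 2 * (n + 1) = (n + 1) + (n + 1) by ring]
    simp only [pow_add, pow_one] at h7 ⊢
    linear_combination (-(p : ℂ) * x ^ n * x) * h7
  have e4 := (funext key ▸ e2).unique e3
  simp only [Finset.range_one, Finset.sum_singleton, pow_zero, hahnExtonCoeff_zero] at e4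
  simp only [hahnExton]
  push_cast at e4
  linear_combination -e4

end HahnExton

/-! ### Location and simplicity of the zeros. -/

/-- A sequence obeying the telescoping law of a Casoratian of two solutions of the `p`-difference
equation, and vanishing at both ends, forces equal spectral parameters. -/
theorem eq_zero_of_casoratian {b p : ℝ} (hb0 : 0 < b) (hb1 : b < 1) (hp0 : 0 < p)
    {W : ℕ → ℂ} {T : ℕ → ℝ} {c L : ℂ}
    (hW : ∀ k, p * W k = c * p ^ (k + 2) * T (k + 1) + b * W (k + 1)) (hW0 : W 0 = 0)
    (hT : ∀ k, 0 ≤ T k) (hT1 : Tendsto T atTop (𝓝 1))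
    (hL : Tendsto (fun k => W k / p ^ k) atTop (𝓝 L)) : c = 0 := by
  by_contra hc
  have hp : (p : ℂ) ≠ 0 := Complex.ofReal_ne_zero.2 hp0.ne'
  -- Dividing the law by `p^(k+1)` and weighting by `b^k` makes it telescope. The left side tends to
  -- 0 because `b < 1`, so the nonnegative partial sums on the right tend to 0.
  have hS : ∀ n, (b : ℂ) ^ n * (W n / p ^ n) =
      -(c * p) * ((∑ k ∈ Finset.range n, b ^ k * T (k + 1) : ℝ) : ℂ) := by
    intro n
    induction n with
    | zero => simp [hW0]
    | succ n ih =>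
      rw [Finset.sum_range_succ, Complex.ofReal_add, mul_add, ← ih]
      have := hW n
      have hP : (p : ℂ) ^ n ≠ 0 := pow_ne_zero n hp
      push_cast
      simp only [pow_succ] at this ⊢
      generalize (p : ℂ) ^ n = P at this hP
      field_simp
      linear_combination (-(b : ℂ) ^ n) * this
  have hb : Tendsto (fun n : ℕ => (b : ℂ) ^ n) atTop (𝓝 0) :=
    tendsto_pow_atTop_nhds_zero_of_norm_lt_one (by
      rw [Complex.norm_real, Real.norm_of_nonneg hb0.le]; exact hb1)
  have h1 := hb.mul hL
  simp only [hS, zero_mul] at h1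
  have hcp : -(c * p) ≠ 0 := neg_ne_zero.2 (mul_ne_zero hc hp)
  have h2 : Tendsto (fun n => ((∑ k ∈ Finset.range n, b ^ k * T (k + 1) : ℝ) : ℂ)) atTop (𝓝 0) := by
    have := h1.const_mul (-(c * p))⁻¹
    rw [mul_zero] at this
    exact this.congr fun n => inv_mul_cancel_left₀ hcp _
  have h3 : Tendsto (fun n => ∑ k ∈ Finset.range n, b ^ k * T (k + 1)) atTop (𝓝 0) := by
    have h := (Complex.continuous_re.tendsto 0).comp h2
    rw [Complex.zero_re] at h
    exact h
  have hmono : Monotone fun n => ∑ k ∈ Finset.range n, b ^ k * T (k + 1) :=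
    monotone_nat_of_le_succ fun n => by
      rw [Finset.sum_range_succ]
      have := mul_nonneg (pow_nonneg hb0.le n) (hT (n + 1))
      linarith
  have h4 : ∀ k, T (k + 1) = 0 := by
    intro k
    have h5 := hmono.ge_of_tendsto h3 (k + 1)
    have h6 := hmono (Nat.zero_le k)
    simp only [Finset.sum_range_succ, Finset.range_zero, Finset.sum_empty] at h5 h6
    have h7 : b ^ k * T (k + 1) ≤ 0 := by linarith
    have h8 : 0 < b ^ k := by positivity
    nlinarith [hT (k + 1)]
  have h5 := (hT1.comp (tendsto_add_atTop_nat 1)).congr h4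
  exact zero_ne_one (tendsto_nhds_unique tendsto_const_nhds h5)

section HahnExton

variable {b p : ℝ}

theorem tendsto_mul_pow (hp0 : 0 < p) (hp1 : p < 1) (x : ℂ) :
    Tendsto (fun k : ℕ => x * (p : ℂ) ^ k) atTop (𝓝 0) := by
  have h : Tendsto (fun n : ℕ => (p : ℂ) ^ n) atTop (𝓝 0) :=
    tendsto_pow_atTop_nhds_zero_of_norm_lt_one (by
      rw [Complex.norm_real, Real.norm_of_nonneg hp0.le]; exact hp1)
  simpa using h.const_mul x

theorem tendsto_hahnExton_mul_pow (hb0 : 0 < b) (hb1 : b < 1) (hp0 : 0 < p) (hp1 : p < 1) (x : ℂ) :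
    Tendsto (fun k : ℕ => hahnExton b p (x * p ^ k)) atTop (𝓝 1) := by
  have h := (differentiable_hahnExton hb0 hb1 hp0 hp1).continuous.tendsto 0
  rw [hahnExton_zero] at h
  exact h.comp (tendsto_mul_pow hp0 hp1 x)

theorem hahnExton_recurrence (hb0 : 0 < b) (hb1 : b < 1) (hp0 : 0 < p) (hp1 : p < 1) (x : ℂ)
    (k : ℕ) : p * hahnExton b p (x * p ^ k) =
      (p + b - p ^ 2 * (x * p ^ k)) * hahnExton b p (x * p ^ (k + 1)) -
        b * hahnExton b p (x * p ^ (k + 2)) := by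
  have h := hahnExton_difference hb0 hb1 hp0 hp1 (x * p ^ k)
  rw [show (p : ℂ) * (x * p ^ k) = x * p ^ (k + 1) by ring,
    show (p : ℂ) ^ 2 * (x * p ^ k) = x * p ^ (k + 2) by ring] at h
  rw [h]
  ring_nf

/-- The zeros of `₁φ₁(0; b; p, p x)` are real. -/
theorem im_eq_zero_of_hahnExton_eq_zero (hb0 : 0 < b) (hb1 : b < 1) (hp0 : 0 < p) (hp1 : p < 1)
    {x : ℂ} (hx : hahnExton b p x = 0) : x.im = 0 := by
  set y := (starRingEnd ℂ) x with hy
  set u : ℕ → ℂ := fun k => hahnExton b p (x * p ^ k) with hu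
  set v : ℕ → ℂ := fun k => hahnExton b p (y * p ^ k) with hv
  have huv : ∀ k, v k = (starRingEnd ℂ) (u k) := fun k => by
    simp only [hu, hv]
    rw [← hahnExton_conj]
    simp [hy]
  have hT : ∀ k, u k * v k = ((Complex.normSq (u k) : ℝ) : ℂ) := fun k => by
    rw [huv, Complex.mul_conj]
  have hu1 := tendsto_hahnExton_mul_pow hb0 hb1 hp0 hp1 x
  have hv1 := tendsto_hahnExton_mul_pow hb0 hb1 hp0 hp1 y
  have hcont : Continuous (dslope (hahnExton b p) 0) :=
    continuousOn_univ.1 ((Complex.differentiableOn_dslope univ_mem).2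
      (differentiable_hahnExton hb0 hb1 hp0 hp1).differentiableOn).continuousOn
  have hlin : ∀ w : ℂ, hahnExton b p w = 1 + w * dslope (hahnExton b p) 0 w := fun w => by
    have := sub_smul_dslope (hahnExton b p) 0 w
    rw [hahnExton_zero, smul_eq_mul, sub_zero] at this
    rw [this]; ring
  have hd : ∀ w : ℂ, Tendsto (fun k : ℕ => dslope (hahnExton b p) 0 (w * p ^ k)) atTop
      (𝓝 (dslope (hahnExton b p) 0 0)) := fun w =>
    (hcont.tendsto 0).comp (tendsto_mul_pow hp0 hp1 w)
  have hp : (p : ℂ) ≠ 0 := Complex.ofReal_ne_zero.2 hp0.ne'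
  -- Since `F w = 1 + w · dslope F 0 w`, increments along `w p^k` are of order `p^k`; this controls
  -- the Casoratian at infinity.
  have hinc : ∀ w : ℂ, ∃ L : ℂ, Tendsto (fun k : ℕ =>
      (hahnExton b p (w * p ^ (k + 1)) - hahnExton b p (w * p ^ k)) / p ^ k) atTop (𝓝 L) := by
    intro w
    have h1 := ((((hd w).comp (tendsto_add_atTop_nat 1)).const_mul (p : ℂ)).sub (hd w)).const_mul w
    refine ⟨_, h1.congr fun k => ?_⟩
    simp only [Function.comp]
    rw [hlin (w * p ^ (k + 1)), hlin (w * p ^ k)]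
    field_simp
    ring
  obtain ⟨L, hL⟩ := hinc x
  obtain ⟨M, hM⟩ := hinc y
  have h0 : y - x = 0 := by
    refine eq_zero_of_casoratian (W := fun k => u k * v (k + 1) - u (k + 1) * v k)
      (T := fun k => Complex.normSq (u k)) hb0 hb1 hp0 (fun k => ?_) ?_
      (fun k => Complex.normSq_nonneg _) ?_ (L := 1 * M - L * 1) ?_
    · have e1 := hahnExton_recurrence hb0 hb1 hp0 hp1 x k
      have e2 := hahnExton_recurrence hb0 hb1 hp0 hp1 y k
      rw [← hT]
      simp only [hu, hv] at e1 e2 ⊢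
      linear_combination hahnExton b p (y * p ^ (k + 1)) * e1 - hahnExton b p (x * p ^ (k + 1)) * e2
    · have : u 0 = 0 := by simp [hu, hx]
      simp [huv, this]
    · have h2 := (Complex.continuous_normSq.tendsto _).comp hu1
      rw [map_one] at h2
      exact h2
    · refine ((hu1.mul hM).sub (hL.mul hv1)).congr fun k => ?_
      simp only [hu, hv]
      ring
  exact Complex.conj_eq_iff_im.1 (sub_eq_zero.1 h0)

/-- The zeros of `₁φ₁(0; b; p, p x)` are simple. -/
theorem deriv_hahnExton_ne_zero (hb0 : 0 < b) (hb1 : b < 1) (hp0 : 0 < p) (hp1 : p < 1)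
    {x : ℂ} (hx : hahnExton b p x = 0) : deriv (hahnExton b p) x ≠ 0 := by
  intro hx'
  have hF := differentiable_hahnExton hb0 hb1 hp0 hp1
  have him := im_eq_zero_of_hahnExton_eq_zero hb0 hb1 hp0 hp1 hx
  obtain ⟨r, rfl⟩ : ∃ r : ℝ, x = r := ⟨x.re, Complex.ext rfl (by simpa using him)⟩
  set u : ℕ → ℂ := fun k => hahnExton b p (r * p ^ k) with hu
  set d : ℕ → ℂ := fun k => deriv (hahnExton b p) (r * p ^ k) with hd
  have hT : ∀ k, u k ^ 2 = ((Complex.normSq (u k) : ℝ) : ℂ) := fun k => by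
    have h1 : (starRingEnd ℂ) (u k) = u k := by
      simp only [hu]
      rw [← hahnExton_conj]
      simp
    rw [← Complex.mul_conj, h1, sq]
  have hu1 := tendsto_hahnExton_mul_pow hb0 hb1 hp0 hp1 r
  have hcont : Continuous (deriv (hahnExton b p)) := hF.contDiff.continuous_deriv le_top
  have hd1 : Tendsto d atTop (𝓝 (deriv (hahnExton b p) 0)) :=
    (hcont.tendsto 0).comp (tendsto_mul_pow hp0 hp1 r)
  -- The difference equation differentiated in `w`. The term `p² F(p w)` comes from the spectral
  -- parameter.
  have hderiv : ∀ w : ℂ, p * deriv (hahnExton b p) w =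
      (p + b - p ^ 2 * w) * (p * deriv (hahnExton b p) (p * w)) - p ^ 2 * hahnExton b p (p * w) -
        b * (p ^ 2 * deriv (hahnExton b p) (p ^ 2 * w)) := by
    intro w
    have hc : ∀ c : ℂ, HasDerivAt (fun w => hahnExton b p (c * w))
        (c * deriv (hahnExton b p) (c * w)) w := fun c => by
      have h1 := (hF (c * w)).hasDerivAt.comp w ((hasDerivAt_id w).const_mul c)
      simpa [mul_comm, Function.comp_def] using h1
    have e1 := (hF w).hasDerivAt.const_mul (p : ℂ)
    have e2 := ((((hasDerivAt_id w).const_mul ((p : ℂ) ^ 2)).const_sub ((p : ℂ) + b)).mul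
      (hc p)).sub ((hc (p ^ 2)).const_mul (b : ℂ))
    have e3 := e2.congr_of_eventuallyEq (f₁ := fun w => p * hahnExton b p w)
      (Eventually.of_forall fun w => by
        simpa using hahnExton_difference hb0 hb1 hp0 hp1 w)
    have e4 := e1.unique e3
    simp only [id] at e4
    rw [e4]
    ring
  have hp : (p : ℂ) ≠ 0 := Complex.ofReal_ne_zero.2 hp0.ne'
  -- The second sequence is `d/dr F(r p^k) = p^k F'(r p^k)`. Differentiating the parameter
  -- difference `y - x` in `y` turns the constant `c` into 1.
  have h0 : (1 : ℂ) = 0 := by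
    refine eq_zero_of_casoratian
      (W := fun k => u k * (p ^ (k + 1) * d (k + 1)) - u (k + 1) * (p ^ k * d k))
      (T := fun k => Complex.normSq (u k)) hb0 hb1 hp0 (fun k => ?_) ?_
      (fun k => Complex.normSq_nonneg _) ?_ (L := 1 * (p * deriv (hahnExton b p) 0) -
        1 * deriv (hahnExton b p) 0) ?_
    · have e1 := hahnExton_recurrence hb0 hb1 hp0 hp1 r k
      have e2 := hderiv (r * p ^ k)
      rw [show (p : ℂ) * (r * p ^ k) = r * p ^ (k + 1) by ring,
        show (p : ℂ) ^ 2 * (r * p ^ k) = r * p ^ (k + 2) by ring] at e2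
      rw [← hT]
      simp only [hu, hd] at e1 e2 ⊢
      linear_combination (p ^ (k + 1) * deriv (hahnExton b p) (r * p ^ (k + 1))) * e1 -
        (p ^ k * hahnExton b p (r * p ^ (k + 1))) * e2
    · have h1 : u 0 = 0 := by simp [hu, hx]
      have h2 : d 0 = 0 := by simp [hd, hx']
      simp [h1, h2]
    · have h2 := (Complex.continuous_normSq.tendsto _).comp hu1
      rw [map_one] at h2
      exact h2
    · refine ((hu1.mul ((hd1.comp (tendsto_add_atTop_nat 1)).const_mul (p : ℂ))).sub
        ((hu1.comp (tendsto_add_atTop_nat 1)).mul hd1)).congr fun k => ?_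
      simp only [hu, hd, Function.comp]
      field_simp
      ring
  exact one_ne_zero h0

/-- `₁φ₁(0; b; p, p x)` has no zeros on the negative half-line. -/
theorem hahnExton_ne_zero_of_nonpos (hb0 : 0 < b) (hb1 : b < 1) (hp0 : 0 < p) (hp1 : p < 1)
    {x : ℝ} (hx : x ≤ 0) : hahnExton b p x ≠ 0 := by
  have hs := summable_hahnExton hb0 hb1 hp0 hp1 x
  have hs' : Summable fun n : ℕ => hahnExtonCoeff b p n * x ^ n := by
    have : Summable fun n : ℕ => ((hahnExtonCoeff b p n * x ^ n : ℝ) : ℂ) := by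
      simpa using hs
    exact_mod_cast this
  -- For `x ≤ 0` the sign of `x^n` cancels the alternating sign, so the sum is at least its constant
  -- term 1.
  have hnn : ∀ n : ℕ, 0 ≤ hahnExtonCoeff b p n * x ^ n := by
    intro n
    have h1 := qShift_pos hb0 hb1 hp0 hp1 n
    have h2 := qShift_pos hp0 hp1 hp0 hp1 n
    have h3 : hahnExtonCoeff b p n * x ^ n =
        p ^ (n * (n + 1) / 2) / (qShift p p n * qShift b p n) * (-x) ^ n := by
      rw [hahnExtonCoeff, neg_pow x]
      ring
    rw [h3]
    have h4 : 0 ≤ -x := by linarith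
    positivity
  have h5 : 1 ≤ ∑' n : ℕ, hahnExtonCoeff b p n * x ^ n := by
    have := hs'.le_tsum 0 fun n _ => hnn n
    simpa [hahnExtonCoeff_zero] using this
  have h6 : hahnExton b p x = ((∑' n : ℕ, hahnExtonCoeff b p n * x ^ n : ℝ) : ℂ) := by
    rw [Complex.ofReal_tsum, hahnExton]
    push_cast
    rfl
  rw [h6]
  exact Complex.ofReal_ne_zero.2 (by linarith)

/-- At `x = (p+b)/p²` the middle coefficient of the difference equation vanishes, leaving `p F(x) =
-b F(p²x)`. This contradicts the positivity on `x > 0` that `F 0 = 1` and the intermediate value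
theorem would give in the absence of zeros. -/
theorem exists_pos_hahnExton_eq_zero (hb0 : 0 < b) (hb1 : b < 1) (hp0 : 0 < p) (hp1 : p < 1) :
    ∃ x : ℝ, 0 < x ∧ hahnExton b p x = 0 := by
  by_contra! hne
  set φ : ℝ → ℝ := fun x => (hahnExton b p x).re with hφ
  have hφF : ∀ x : ℝ, hahnExton b p x = φ x := fun x =>
    Complex.ext rfl (by simpa using hahnExton_ofReal_im x)
  have hc : Continuous φ := Complex.continuous_re.comp
    ((differentiable_hahnExton hb0 hb1 hp0 hp1).continuous.comp Complex.continuous_ofReal)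
  have h0 : φ 0 = 1 := by simp [hφ, hahnExton_zero]
  have hpos : ∀ x : ℝ, 0 < x → 0 < φ x := by
    intro x hx
    by_contra hle
    obtain ⟨y, hy, hy0⟩ := intermediate_value_Icc' hx.le hc.continuousOn
      (show (0 : ℝ) ∈ Set.Icc (φ x) (φ 0) from ⟨not_lt.1 hle, by rw [h0]; exact zero_le_one⟩)
    have hy1 : y ≠ 0 := by
      rintro rfl
      rw [h0] at hy0
      exact one_ne_zero hy0
    exact hne y (lt_of_le_of_ne hy.1 hy1.symm) (by rw [hφF, hy0, Complex.ofReal_zero])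
  have hd := hahnExton_difference hb0 hb1 hp0 hp1 (((p + b) / p ^ 2 : ℝ) : ℂ)
  have h1 : (p : ℂ) + b - p ^ 2 * (((p + b) / p ^ 2 : ℝ) : ℂ) = 0 := by
    have hp : (p : ℂ) ≠ 0 := Complex.ofReal_ne_zero.2 hp0.ne'
    push_cast
    field_simp
    ring
  rw [h1, zero_mul, zero_sub, ← Complex.ofReal_pow, ← Complex.ofReal_mul, hφF, hφF] at hd
  have h2 : p * φ ((p + b) / p ^ 2) = -(b * φ (p ^ 2 * ((p + b) / p ^ 2))) := by exact_mod_cast hd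
  have h3 := mul_pos hp0 (hpos ((p + b) / p ^ 2) (by positivity))
  have h4 := mul_pos hb0 (hpos (p ^ 2 * ((p + b) / p ^ 2)) (by positivity))
  linarith

end HahnExton

/-! ### The first Bessel zero. -/

section BesselZero

variable {α q : ℝ}

theorem rpow_add_one_mem_Ioo {α p : ℝ} (hp0 : 0 < p) (hp1 : p < 1) (hα : -1 < α) :
    p ^ (α + 1) ∈ Set.Ioo (0 : ℝ) 1 :=
  ⟨Real.rpow_pos_of_pos hp0 _, Real.rpow_lt_one hp0.le hp1 (by linarith)⟩

theorem sq_mem_Ioo {q : ℝ} (hq0 : 0 < q) (hq1 : q < 1) : q ^ 2 ∈ Set.Ioo (0 : ℝ) 1 :=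
  ⟨by positivity, by nlinarith⟩

theorem besselJ_eq_zero_iff {p : ℝ} (hp0 : 0 < p) (hp1 : p < 1) (hα : -1 < α) {z : ℂ}
    (hz : z ≠ 0) : besselJ α p z = 0 ↔ hahnExton (p ^ (α + 1)) p (z ^ 2) = 0 := by
  obtain ⟨hb0, hb1⟩ := rpow_add_one_mem_Ioo hp0 hp1 hα
  rw [← besselModJ_eq_hahnExton, besselModJ_eq hα hp0 hp1 hz, mul_eq_zero, or_iff_right]
  refine mul_ne_zero (Complex.ofReal_ne_zero.2 (div_ne_zero
    (qShiftInf_ne_zero hp0 hp1 hp0 hp1) (qShiftInf_ne_zero hb0 hb1 hp0 hp1))) ?_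
  rw [Complex.cpow_def_of_ne_zero hz]
  exact Complex.exp_ne_zero _

theorem isLeast_besselZero (hq0 : 0 < q) (hq1 : q < 1) (hα : -1 < α) :
    IsLeast {x : ℝ | 0 < x ∧ besselJ α (q ^ 2) (x : ℂ) = 0} (besselZero α q) := by
  obtain ⟨hp0, hp1⟩ := sq_mem_Ioo hq0 hq1
  obtain ⟨hb0, hb1⟩ := rpow_add_one_mem_Ioo hp0 hp1 hα
  -- Since `F 0 = 1`, `0 < x` may be relaxed to `0 ≤ x`. The set is then closed, so its infimum is
  -- attained.
  have hS : {x : ℝ | 0 < x ∧ besselJ α (q ^ 2) (x : ℂ) = 0} =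
      {x : ℝ | 0 ≤ x} ∩ {x : ℝ | hahnExton ((q ^ 2) ^ (α + 1)) (q ^ 2) ((x : ℂ) ^ 2) = 0} := by
    ext x
    simp only [Set.mem_ofPred_eq, Set.mem_inter_iff]
    constructor
    · rintro ⟨h1, h2⟩
      exact ⟨h1.le, (besselJ_eq_zero_iff hp0 hp1 hα (Complex.ofReal_ne_zero.2 h1.ne')).1 h2⟩
    · rintro ⟨h1, h2⟩
      have hx : x ≠ 0 := by
        rintro rfl
        simp [hahnExton_zero] at h2
      exact ⟨lt_of_le_of_ne h1 hx.symm,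
        (besselJ_eq_zero_iff hp0 hp1 hα (Complex.ofReal_ne_zero.2 hx)).2 h2⟩
  rw [besselZero, hS]
  have hcl : IsClosed ({x : ℝ | 0 ≤ x} ∩
      {x : ℝ | hahnExton ((q ^ 2) ^ (α + 1)) (q ^ 2) ((x : ℂ) ^ 2) = 0}) := by
    refine (isClosed_le continuous_const continuous_id).inter (isClosed_eq ?_ continuous_const)
    exact (differentiable_hahnExton hb0 hb1 hp0 hp1).continuous.comp
      (Complex.continuous_ofReal.pow 2)
  have hbdd : BddBelow ({x : ℝ | 0 ≤ x} ∩
      {x : ℝ | hahnExton ((q ^ 2) ^ (α + 1)) (q ^ 2) ((x : ℂ) ^ 2) = 0}) := ⟨0, fun x hx => hx.1⟩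
  obtain ⟨x, hx, hx0⟩ := exists_pos_hahnExton_eq_zero hb0 hb1 hp0 hp1
  refine ⟨hcl.csInf_mem ⟨√x, Real.sqrt_nonneg x, ?_⟩ hbdd, fun y hy => csInf_le hbdd hy⟩
  rw [Set.mem_ofPred_eq, ← Complex.ofReal_pow, Real.sq_sqrt hx.le, hx0]

theorem besselZero_pos (hq0 : 0 < q) (hq1 : q < 1) (hα : -1 < α) : 0 < besselZero α q :=
  (isLeast_besselZero hq0 hq1 hα).1.1

theorem hahnExton_besselZero_sq (hq0 : 0 < q) (hq1 : q < 1) (hα : -1 < α) :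
    hahnExton ((q ^ 2) ^ (α + 1)) (q ^ 2) ((besselZero α q : ℂ) ^ 2) = 0 := by
  obtain ⟨hp0, hp1⟩ := sq_mem_Ioo hq0 hq1
  obtain ⟨h1, h2⟩ := (isLeast_besselZero hq0 hq1 hα).1
  exact (besselJ_eq_zero_iff hp0 hp1 hα (Complex.ofReal_ne_zero.2 h1.ne')).1 h2

/-- The square of the first Bessel zero is the only zero of `₁φ₁(0; b; p, p x)` in the closed disc
through it. -/
theorem eq_besselZero_sq_of_hahnExton_eq_zero (hq0 : 0 < q) (hq1 : q < 1) (hα : -1 < α) {x : ℂ}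
    (hx : ‖x‖ ≤ besselZero α q ^ 2) (h0 : hahnExton ((q ^ 2) ^ (α + 1)) (q ^ 2) x = 0) :
    x = (besselZero α q : ℂ) ^ 2 := by
  obtain ⟨hp0, hp1⟩ := sq_mem_Ioo hq0 hq1
  obtain ⟨hb0, hb1⟩ := rpow_add_one_mem_Ioo hp0 hp1 hα
  have him := im_eq_zero_of_hahnExton_eq_zero hb0 hb1 hp0 hp1 h0
  obtain ⟨r, rfl⟩ : ∃ r : ℝ, x = r := ⟨x.re, Complex.ext rfl (by simpa using him)⟩
  have hr : 0 < r := by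
    by_contra hle
    exact hahnExton_ne_zero_of_nonpos hb0 hb1 hp0 hp1 (not_lt.1 hle) h0
  rw [Complex.norm_real, Real.norm_of_nonneg hr.le] at hx
  have hs : 0 < √r := Real.sqrt_pos.2 hr
  have h1 : besselZero α q ≤ √r := by
    refine (isLeast_besselZero hq0 hq1 hα).2 ⟨hs, ?_⟩
    rw [besselJ_eq_zero_iff hp0 hp1 hα (Complex.ofReal_ne_zero.2 hs.ne'), ← Complex.ofReal_pow,
      Real.sq_sqrt hr.le, h0]
  have h2 : besselZero α q ^ 2 ≤ r := by
    rw [← Real.sq_sqrt hr.le]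
    exact pow_le_pow_left₀ (besselZero_pos hq0 hq1 hα).le h1 2
  rw [← Complex.ofReal_pow, le_antisymm hx h2]

/-- The derivative of the modified function at its first positive zero, through the quotient of
`₁φ₁(0; b; p, p x)` by the corresponding linear factor. -/
theorem deriv_besselModJ_besselZero (hq0 : 0 < q) (hq1 : q < 1) (hα : -1 < α) :
    deriv (besselModJ α (q ^ 2)) (besselZero α q : ℂ) = 2 * (besselZero α q : ℂ) *
      dslope (hahnExton ((q ^ 2) ^ (α + 1)) (q ^ 2)) ((besselZero α q : ℂ) ^ 2)
        ((besselZero α q : ℂ) ^ 2) := by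
  obtain ⟨hp0, hp1⟩ := sq_mem_Ioo hq0 hq1
  obtain ⟨hb0, hb1⟩ := rpow_add_one_mem_Ioo hp0 hp1 hα
  have h1 : besselModJ α (q ^ 2) = fun z => hahnExton ((q ^ 2) ^ (α + 1)) (q ^ 2) (z ^ 2) :=
    funext (besselModJ_eq_hahnExton α (q ^ 2))
  have h2 := ((differentiable_hahnExton hb0 hb1 hp0 hp1
    ((besselZero α q : ℂ) ^ 2)).hasDerivAt.comp (besselZero α q : ℂ)
      (hasDerivAt_pow 2 (besselZero α q : ℂ))).deriv
  rw [dslope_same, h1]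
  refine h2.trans ?_
  simp only [Nat.cast_ofNat, Nat.add_one_sub_one, pow_one]
  ring

/-- At `j²` the quotient is the derivative, nonzero by simplicity; elsewhere in the disc a zero
would be a second zero of `F`. The boundary circle is included, which later leaves room to enlarge
the disc. -/
theorem dslope_hahnExton_ne_zero (hq0 : 0 < q) (hq1 : q < 1) (hα : -1 < α) {x : ℂ}
    (hx : ‖x‖ ≤ besselZero α q ^ 2) :
    dslope (hahnExton ((q ^ 2) ^ (α + 1)) (q ^ 2)) ((besselZero α q : ℂ) ^ 2) x ≠ 0 := by
  obtain ⟨hp0, hp1⟩ := sq_mem_Ioo hq0 hq1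
  obtain ⟨hb0, hb1⟩ := rpow_add_one_mem_Ioo hp0 hp1 hα
  rcases eq_or_ne x ((besselZero α q : ℂ) ^ 2) with rfl | hne
  · rw [dslope_same]
    exact deriv_hahnExton_ne_zero hb0 hb1 hp0 hp1 (hahnExton_besselZero_sq hq0 hq1 hα)
  · intro h
    have h1 := sub_smul_dslope (hahnExton ((q ^ 2) ^ (α + 1)) (q ^ 2)) ((besselZero α q : ℂ) ^ 2) x
    rw [h, smul_zero, hahnExton_besselZero_sq hq0 hq1 hα, sub_zero] at h1
    exact hne (eq_besselZero_sq_of_hahnExton_eq_zero hq0 hq1 hα hx h1.symm)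

end BesselZero

/-! ### Darboux's method for Taylor coefficients. -/

theorem iteratedDeriv_inv_sub_zero {s : ℂ} (hs : s ≠ 0) (n : ℕ) :
    iteratedDeriv n (fun t : ℂ => (t - s)⁻¹) 0 / n.factorial = -(s ^ (n + 1))⁻¹ := by
  have h := congrFun (iter_deriv_inv_linear_sub n (1 : ℂ) s) 0
  simp only [one_mul] at h
  rw [iteratedDeriv_eq_iterate, h]
  have h1 : (n.factorial : ℂ) ≠ 0 := Nat.cast_ne_zero.2 n.factorial_ne_zero
  have h2 : (0 - s) ^ (-1 - n : ℤ) = ((-s) ^ (n + 1))⁻¹ := by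
    rw [zero_sub, ← zpow_natCast, ← zpow_neg]
    congr 1
    push_cast
    ring
  rw [h2, neg_pow s, one_pow, mul_inv, pow_succ]
  have h3 : ((-1 : ℂ)) ^ n * ((-1) ^ n)⁻¹ = 1 := mul_inv_cancel₀ (by simp)
  field_simp

/-- Darboux's method for two simple poles at `±s`: the Taylor coefficients at the origin are those
of the principal parts, up to a geometrically smaller error. -/
theorem exists_norm_taylor_sub_le {A : ℂ → ℂ} {s : ℂ} {R : ℝ} (hs : s ≠ 0) (hsR : ‖s‖ < R)
    (hA : DifferentiableOn ℂ A (Metric.ball 0 R)) :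
    ∃ ρ > ‖s‖, ∃ M : ℝ, ∀ n : ℕ,
      ‖iteratedDeriv n (fun t => A t / (t ^ 2 - s ^ 2)) 0 / n.factorial -
        (A (-s) / (2 * s) / (-s) ^ (n + 1) - A s / (2 * s) / s ^ (n + 1))‖ ≤ M / ρ ^ n := by
  have hs0 : 0 < ‖s‖ := norm_pos_iff.2 hs
  have hball : ∀ w : ℂ, ‖w‖ < R → Metric.ball (0 : ℂ) R ∈ 𝓝 w := fun w hw =>
    Metric.isOpen_ball.mem_nhds (by simpa using hw)
  -- `B` is the second divided difference in Newton's interpolation of `A` at `s` and `-s`, hence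
  -- the holomorphic part left after removing both poles. Cauchy's estimate on a circle of radius `ρ
  -- > ‖s‖` bounds its coefficients.
  set B := dslope (dslope A s) (-s) with hBdef
  have hB : DifferentiableOn ℂ B (Metric.ball 0 R) :=
    (Complex.differentiableOn_dslope (hball (-s) (by simpa using hsR))).2
      ((Complex.differentiableOn_dslope (hball s hsR)).2 hA)
  obtain ⟨ρ, hsρ, hρR⟩ := exists_between hsR
  have hρ0 : 0 < ρ := hs0.trans hsρ
  have hsub : Metric.closedBall (0 : ℂ) ρ ⊆ Metric.ball 0 R := Metric.closedBall_subset_ball hρR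
  obtain ⟨M, hM⟩ := (isCompact_sphere (0 : ℂ) ρ).exists_bound_of_continuousOn
    (hB.continuousOn.mono (Metric.sphere_subset_closedBall.trans hsub))
  refine ⟨ρ, hsρ, M, fun n => ?_⟩
  have hcauchy : ‖iteratedDeriv n B 0‖ ≤ n.factorial * M / ρ ^ n :=
    Complex.norm_iteratedDeriv_le_of_forall_mem_sphere_norm_le n hρ0
      ((hB.mono hsub).diffContOnCl_ball subset_rfl) hM
  have hs2 : (2 : ℂ) * s ≠ 0 := mul_ne_zero two_ne_zero hs
  have hEq : (fun t => A t / (t ^ 2 - s ^ 2)) =ᶠ[𝓝 0] fun t =>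
      (A s / (2 * s) * (t - s)⁻¹ + -(A (-s) / (2 * s)) * (t - -s)⁻¹) + B t := by
    filter_upwards [eventually_ne_nhds hs.symm, eventually_ne_nhds (neg_ne_zero.2 hs).symm]
      with t h1 h2
    have e1 := sub_smul_dslope A s t
    have e2 := sub_smul_dslope (dslope A s) (-s) t
    have e3 := sub_smul_dslope A s (-s)
    simp only [smul_eq_mul, ← hBdef] at e1 e2 e3
    have h1' : t - s ≠ 0 := sub_ne_zero.2 h1
    have h2' : t + s ≠ 0 := by simpa using sub_ne_zero.2 h2
    have h3 : t ^ 2 - s ^ 2 ≠ 0 := by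
      rw [show t ^ 2 - s ^ 2 = (t - s) * (t + s) by ring]
      exact mul_ne_zero h1' h2'
    rw [sub_neg_eq_add, div_eq_iff h3]
    rw [sub_neg_eq_add] at e2
    have e4 : A t = A s + (t - s) * (dslope A s (-s) + (t + s) * B t) := by
      rw [e2]
      linear_combination -e1
    have e5 : dslope A s (-s) = (A s - A (-s)) / (2 * s) := by
      rw [eq_div_iff hs2]
      linear_combination -e3
    rw [e4, e5]
    field_simp
    ring
  have hinv : ∀ w : ℂ, w ≠ 0 → ContDiffAt ℂ n (fun t : ℂ => (t - w)⁻¹) 0 := fun w hw =>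
    (contDiffAt_id.sub contDiffAt_const).inv (by simpa using hw)
  have hBc : ContDiffAt ℂ n B 0 :=
    (hB.analyticAt (hball 0 (by simpa using hs0.trans hsR))).contDiffAt
  have hc1 := (contDiffAt_const (c := A s / (2 * s))).mul (hinv s hs)
  have hc2 := (contDiffAt_const (c := -(A (-s) / (2 * s)))).mul (hinv (-s) (neg_ne_zero.2 hs))
  have e1 := iteratedDeriv_inv_sub_zero hs n
  have e2 := iteratedDeriv_inv_sub_zero (neg_ne_zero.2 hs) n
  rw [hEq.iteratedDeriv_eq, iteratedDeriv_fun_add (hc1.add hc2) hBc, iteratedDeriv_fun_add hc1 hc2,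
    iteratedDeriv_const_mul_field, iteratedDeriv_const_mul_field]
  have h1 : (n.factorial : ℂ) ≠ 0 := Nat.cast_ne_zero.2 n.factorial_ne_zero
  have e3 : (A s / (2 * s) * iteratedDeriv n (fun t : ℂ => (t - s)⁻¹) 0 +
      -(A (-s) / (2 * s)) * iteratedDeriv n (fun t : ℂ => (t - -s)⁻¹) 0 + iteratedDeriv n B 0) /
        n.factorial -
        (A (-s) / (2 * s) / (-s) ^ (n + 1) - A s / (2 * s) / s ^ (n + 1)) =
      iteratedDeriv n B 0 / n.factorial := by
    rw [div_eq_mul_inv (A (-s) / (2 * s)), div_eq_mul_inv (A s / (2 * s))]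
    linear_combination (A s / (2 * s)) * e1 - (A (-s) / (2 * s)) * e2
  rw [e3, norm_div, Complex.norm_natCast, div_le_iff₀ (by positivity)]
  refine hcauchy.trans_eq ?_
  ring

theorem isLittleO_mul_of_norm_le_div_pow {e : ℕ → ℂ} {M ρ r : ℝ} (hr0 : 0 < r) (hr : r < ρ)
    (he : ∀ n, ‖e n‖ ≤ M / ρ ^ n) (Q : ℕ → ℝ) (i : ℕ) :
    (fun n : ℕ => (Q n : ℂ) * e (2 * n + i)) =o[atTop] fun n : ℕ => Q n * (r ^ (2 * n))⁻¹ := by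
  have hρ : 0 < ρ := hr0.trans hr
  refine IsBigO.mul_isLittleO (IsBigO.of_bound 1 (Eventually.of_forall fun n => by simp)) ?_
  have h1 : (fun n : ℕ => e (2 * n + i)) =O[atTop] fun n : ℕ => ((ρ ^ 2)⁻¹) ^ n := by
    refine IsBigO.of_bound (M / ρ ^ i) (Eventually.of_forall fun n => (he _).trans_eq ?_)
    rw [Real.norm_of_nonneg (by positivity), inv_pow, pow_add, pow_mul]
    field_simp
  have h2 : (fun n : ℕ => ((ρ ^ 2)⁻¹) ^ n) =o[atTop] fun n : ℕ => ((r ^ 2)⁻¹) ^ n :=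
    isLittleO_pow_pow_of_lt_left (by positivity)
      (inv_strictAnti₀ (by positivity) (pow_lt_pow_left₀ hr hr0.le two_ne_zero))
  refine (h1.trans_isLittleO h2).congr_right fun n => ?_
  rw [inv_pow, pow_mul]

/-! ### Algebra of the principal parts. -/

section PrincipalParts

variable {c η κ : ℂ}

theorem two_I_mul_pow_odd (η : ℂ) (n : ℕ) :
    (2 * I * η) ^ (2 * n + 1) = I * (-1) ^ n * (2 * η) ^ (2 * n + 1) := by
  rw [show 2 * I * η = I * (2 * η) by ring, mul_pow, pow_succ I, pow_mul, I_sq]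
  ring

/-- Here `u` and `v` stand for the exponential products at `2iη` and `-2iη`, and `2(cη)κ` is the
derivative of the modified Bessel function at `j = cη`. The parity of the index decides whether the
two poles contribute a sum or a difference. -/
theorem principalPart_even (hc : c ≠ 0) (hη : η ≠ 0) (hκ : κ ≠ 0) (u v : ℂ) (n : ℕ) :
    -(4 / c ^ 2) * v / κ / (2 * (2 * I * η)) / (-(2 * I * η)) ^ (2 * n + 1) -
        -(4 / c ^ 2) * u / κ / (2 * (2 * I * η)) / (2 * I * η) ^ (2 * n + 1) =
      4 / c * ((-1) ^ (n + 1) * ((u + v) / 2)) /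
        ((2 * η) ^ (2 * n + 1) * (2 * (c * η) * κ)) := by
  have hP : (2 * η) ^ (2 * n + 1) ≠ 0 := pow_ne_zero _ (mul_ne_zero two_ne_zero hη)
  have hI := I_ne_zero
  rw [Odd.neg_pow ⟨n, rfl⟩, two_I_mul_pow_odd, pow_succ (-1 : ℂ)]
  generalize (2 * η) ^ (2 * n + 1) = P at hP
  rcases neg_one_pow_eq_or ℂ n with h | h <;> rw [h] <;> field_simp <;> rw [I_sq] <;> ring

theorem principalPart_odd (hc : c ≠ 0) (hη : η ≠ 0) (hκ : κ ≠ 0) (u v : ℂ) (n : ℕ) :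
    -(4 / c ^ 2) * v / κ / (2 * (2 * I * η)) / (-(2 * I * η)) ^ (2 * n + 1 + 1) -
        -(4 / c ^ 2) * u / κ / (2 * (2 * I * η)) / (2 * I * η) ^ (2 * n + 1 + 1) =
      4 / c * ((-1) ^ (n + 1) * ((u - v) / (2 * I))) /
        ((2 * η) ^ (2 * n + 2) * (2 * (c * η) * κ)) := by
  have hP : (2 * η) ^ (2 * n + 2) ≠ 0 := pow_ne_zero _ (mul_ne_zero two_ne_zero hη)
  have hI := I_ne_zero
  have h1 : (2 * I * η) ^ (2 * n + 1 + 1) = -(-1) ^ n * (2 * η) ^ (2 * n + 2) := by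
    rw [pow_succ, two_I_mul_pow_odd]
    linear_combination ((-1) ^ n * (2 * η) ^ (2 * n + 1) * (2 * η)) * I_sq
  rw [Even.neg_pow ⟨n + 1, by ring⟩, h1, pow_succ (-1 : ℂ)]
  generalize (2 * η) ^ (2 * n + 2) = P at hP
  rcases neg_one_pow_eq_or ℂ n with h | h <;> rw [h] <;> field_simp <;> ring

end PrincipalParts

theorem qCos_mul_add_qSin_mul (q : ℝ) (x y : ℂ) :
    qCos q x * qCos q y + qSin q x * qSin q y =
      (qExp q (I * x) * qExp q (-(I * y)) + qExp q (-(I * x)) * qExp q (I * y)) / 2 := by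
  have hI := I_ne_zero
  rw [qCos, qCos, qSin, qSin]
  field_simp
  rw [I_sq]
  ring

theorem qSin_mul_sub_qCos_mul (q : ℝ) (x y : ℂ) :
    qSin q x * qCos q y - qCos q x * qSin q y =
      (qExp q (I * x) * qExp q (-(I * y)) - qExp q (-(I * x)) * qExp q (I * y)) / (2 * I) := by
  have hI := I_ne_zero
  rw [qCos, qCos, qSin, qSin]
  field_simp
  ring

/-! ### Factoring the poles out of the generating function. -/

section GeneratingFunction

variable {α q : ℝ}

/-- The generating function multiplied by `t² + 4 η²`, which removes its poles closest to the
origin. -/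
def genFunNumerator (α q : ℝ) (z t : ℂ) : ℂ :=
  -(4 / (((1 - q) * q ^ (-(1 / 4) : ℝ) : ℝ) : ℂ) ^ 2) * (qExp q (z * t) * qExp q (-t / 2)) /
    dslope (hahnExton ((q ^ 2) ^ (α + 1)) (q ^ 2)) ((besselZero α q : ℂ) ^ 2)
      (-((((1 - q) * q ^ (-(1 / 4) : ℝ) : ℝ) : ℂ) ^ 2 / 4) * t ^ 2)

theorem eta_pos (hq0 : 0 < q) (hq1 : q < 1) (hα : -1 < α) : 0 < eta α q :=
  div_pos (mul_pos (Real.rpow_pos_of_pos hq0 _) (besselZero_pos hq0 hq1 hα)) (by linarith)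

theorem scale_pos (hq0 : 0 < q) (hq1 : q < 1) : 0 < (1 - q) * q ^ (-(1 / 4) : ℝ) :=
  mul_pos (by linarith) (Real.rpow_pos_of_pos hq0 _)

theorem scale_mul_eta (hq0 : 0 < q) (hq1 : q < 1) :
    (1 - q) * q ^ (-(1 / 4) : ℝ) * eta α q = besselZero α q := by
  have h1 : (1 - q) ≠ 0 := by linarith
  have h2 : q ^ (1 / 4 : ℝ) ≠ 0 := (Real.rpow_pos_of_pos hq0 _).ne'
  rw [eta, Real.rpow_neg hq0.le]
  field_simp

theorem four_div_scale (hq0 : 0 < q) :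
    4 * ((q ^ (1 / 4 : ℝ) : ℝ) : ℂ) / (1 - (q : ℂ)) =
      4 / (((1 - q) * q ^ (-(1 / 4) : ℝ) : ℝ) : ℂ) := by
  rw [Real.rpow_neg hq0.le]
  push_cast
  rw [div_mul_eq_div_div, div_inv_eq_mul]
  ring

/-- Since `j = cη`, one has `-c²t²/4 - j² = -(c²/4)(t² - (2iη)²)`. With division by zero equal to 0,
the identity holds even at the poles, so it can be used as an equality of functions. -/
theorem genFun_eq_div (hq0 : 0 < q) (hq1 : q < 1) (hα : -1 < α) (z t : ℂ) :
    genFun α q z t = genFunNumerator α q z t / (t ^ 2 - (2 * I * (eta α q : ℂ)) ^ 2) := by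
  have hj : (besselZero α q : ℂ) =
      (((1 - q) * q ^ (-(1 / 4) : ℝ) : ℝ) : ℂ) * (eta α q : ℂ) := by
    rw [← Complex.ofReal_mul, scale_mul_eta hq0 hq1]
  have hc : (((1 - q) * q ^ (-(1 / 4) : ℝ) : ℝ) : ℂ) ≠ 0 :=
    Complex.ofReal_ne_zero.2 (scale_pos hq0 hq1).ne'
  have h1 := sub_smul_dslope (hahnExton ((q ^ 2) ^ (α + 1)) (q ^ 2)) ((besselZero α q : ℂ) ^ 2)
    (-((((1 - q) * q ^ (-(1 / 4) : ℝ) : ℝ) : ℂ) ^ 2 / 4) * t ^ 2)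
  rw [hahnExton_besselZero_sq hq0 hq1 hα, sub_zero, smul_eq_mul] at h1
  have h2 : gBessel α q (I * t) = hahnExton ((q ^ 2) ^ (α + 1)) (q ^ 2)
      (-((((1 - q) * q ^ (-(1 / 4) : ℝ) : ℝ) : ℂ) ^ 2 / 4) * t ^ 2) := by
    rw [gBessel, besselModJ_eq_hahnExton]
    congr 1
    push_cast
    ring_nf
    rw [I_sq]
    ring
  have h3 : -((((1 - q) * q ^ (-(1 / 4) : ℝ) : ℝ) : ℂ) ^ 2 / 4) * t ^ 2 -
      (besselZero α q : ℂ) ^ 2 = -((((1 - q) * q ^ (-(1 / 4) : ℝ) : ℝ) : ℂ) ^ 2 / 4) *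
        (t ^ 2 - (2 * I * (eta α q : ℂ)) ^ 2) := by
    rw [hj]
    linear_combination (-(((1 - q) * q ^ (-(1 / 4) : ℝ) : ℝ) : ℂ) ^ 2 * (eta α q : ℂ) ^ 2) * I_sq
  rw [genFun, genFunNumerator, h2, ← h1, h3]
  simp only [div_eq_mul_inv, mul_inv, inv_neg, inv_inv]
  ring

theorem exists_differentiableOn_genFunNumerator (hq0 : 0 < q) (hq1 : q < 1) (hα : -1 < α) (z : ℂ) :
    ∃ R > 2 * eta α q, DifferentiableOn ℂ (genFunNumerator α q z) (Metric.ball 0 R) := by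
  obtain ⟨hp0, hp1⟩ := sq_mem_Ioo hq0 hq1
  obtain ⟨hb0, hb1⟩ := rpow_add_one_mem_Ioo hp0 hp1 hα
  have hη := eta_pos hq0 hq1 hα
  have hc := scale_pos hq0 hq1
  have hK : Differentiable ℂ fun t : ℂ => dslope (hahnExton ((q ^ 2) ^ (α + 1)) (q ^ 2))
      ((besselZero α q : ℂ) ^ 2) (-((((1 - q) * q ^ (-(1 / 4) : ℝ) : ℝ) : ℂ) ^ 2 / 4) * t ^ 2) := by
    have h := differentiableOn_univ.1 ((Complex.differentiableOn_dslope
      (c := (besselZero α q : ℂ) ^ 2) univ_mem).2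
        (differentiable_hahnExton hb0 hb1 hp0 hp1).differentiableOn)
    exact h.comp (by fun_prop)
  have hE := differentiable_qExp hq0 hq1
  -- For `|t| ≤ 2η` the argument has modulus at most `c²η² = j²`. By compactness the denominator
  -- stays nonzero on a slightly larger disc.
  obtain ⟨δ, hδ, hsub⟩ := (isCompact_closedBall (0 : ℂ) (2 * eta α q)).exists_cthickening_subset_open
    (isOpen_ne_fun hK.continuous continuous_const) (fun t ht => dslope_hahnExton_ne_zero hq0 hq1 hα (by
      rw [mem_closedBall_zero_iff] at ht
      rw [norm_mul, norm_neg, norm_div, norm_pow, norm_pow, Complex.norm_real,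
        Real.norm_of_nonneg hc.le, ← scale_mul_eta (α := α) hq0 hq1]
      have h1 : ‖t‖ ^ 2 ≤ (2 * eta α q) ^ 2 := pow_le_pow_left₀ (norm_nonneg _) ht 2
      have h2 : ‖(4 : ℂ)‖ = 4 := by simp
      rw [h2]
      calc _ ≤ ((1 - q) * q ^ (-(1 / 4) : ℝ)) ^ 2 / 4 * (2 * eta α q) ^ 2 := by gcongr
        _ = _ := by ring))
  rw [cthickening_closedBall hδ.le (by positivity)] at hsub
  refine ⟨2 * eta α q + δ, by linarith, fun t ht => ?_⟩
  have hne := hsub (by rw [add_comm]; exact Metric.ball_subset_closedBall ht)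
  refine DifferentiableAt.differentiableWithinAt (DifferentiableAt.div ?_ (hK t) hne)
  exact ((((hE.comp (differentiable_id.const_mul z)).mul
    (hE.comp (differentiable_id.neg.div_const 2))).const_mul _) t)

end GeneratingFunction

end QBern

end

/-! ### Assembly of the asymptotic formulas. -/

open Asymptotics Filter in
theorem theorem3p6 (q α : ℝ) (hq0 : 0 < q) (hq1 : q < 1) (hα : -1 < α) :
    IsLeast {x : ℝ | 0 < x ∧ QBern.besselJ α (q ^ 2) (x : ℂ) = 0} (QBern.besselZero α q) ∧
    deriv (QBern.besselModJ α (q ^ 2)) (QBern.besselZero α q : ℂ) ≠ 0 ∧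
    ∀ (z : ℂ) (r : ℝ), 0 < r → r ≤ 2 * QBern.eta α q →
      ((fun n : ℕ => QBern.qBernoulli α q (2 * n) z -
          4 * ((q ^ (1 / 4 : ℝ) : ℝ) : ℂ) / (1 - (q : ℂ)) *
            ((-1) ^ (n + 1) * (QBern.qFact q (2 * n) : ℂ) *
              (QBern.qCos q (2 * (QBern.eta α q : ℂ) * z) * QBern.qCos q (QBern.eta α q : ℂ) +
                QBern.qSin q (2 * (QBern.eta α q : ℂ) * z) * QBern.qSin q (QBern.eta α q : ℂ))) /
            ((2 * (QBern.eta α q : ℂ)) ^ (2 * n + 1) *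
              deriv (QBern.besselModJ α (q ^ 2)) (QBern.besselZero α q : ℂ)))
        =o[atTop] fun n : ℕ => QBern.qFact q (2 * n) * (r ^ (2 * n))⁻¹) ∧
      ((fun n : ℕ => QBern.qBernoulli α q (2 * n + 1) z -
          4 * ((q ^ (1 / 4 : ℝ) : ℝ) : ℂ) / (1 - (q : ℂ)) *
            ((-1) ^ (n + 1) * (QBern.qFact q (2 * n + 1) : ℂ) *
              (QBern.qSin q (2 * (QBern.eta α q : ℂ) * z) * QBern.qCos q (QBern.eta α q : ℂ) -
                QBern.qCos q (2 * (QBern.eta α q : ℂ) * z) * QBern.qSin q (QBern.eta α q : ℂ))) /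
            ((2 * (QBern.eta α q : ℂ)) ^ (2 * n + 2) *
              deriv (QBern.besselModJ α (q ^ 2)) (QBern.besselZero α q : ℂ)))
        =o[atTop] fun n : ℕ => QBern.qFact q (2 * n + 1) * (r ^ (2 * n))⁻¹) := by
  have hj := QBern.besselZero_pos hq0 hq1 hα
  have hη := QBern.eta_pos hq0 hq1 hα
  have hD := QBern.deriv_besselModJ_besselZero hq0 hq1 hα
  have hκ := QBern.dslope_hahnExton_ne_zero hq0 hq1 hα
    (x := (QBern.besselZero α q : ℂ) ^ 2) (by
      rw [norm_pow, Complex.norm_real, Real.norm_of_nonneg hj.le])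
  refine ⟨QBern.isLeast_besselZero hq0 hq1 hα, ?_, fun z r hr0 hr => ?_⟩
  · rw [hD]
    exact mul_ne_zero (mul_ne_zero two_ne_zero (Complex.ofReal_ne_zero.2 hj.ne')) hκ
  have hηC : (QBern.eta α q : ℂ) ≠ 0 := Complex.ofReal_ne_zero.2 hη.ne'
  have hcC : (((1 - q) * q ^ (-(1 / 4) : ℝ) : ℝ) : ℂ) ≠ 0 :=
    Complex.ofReal_ne_zero.2 (QBern.scale_pos hq0 hq1).ne'
  have hjC : (QBern.besselZero α q : ℂ) =
      (((1 - q) * q ^ (-(1 / 4) : ℝ) : ℝ) : ℂ) * (QBern.eta α q : ℂ) := by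
    rw [← Complex.ofReal_mul, QBern.scale_mul_eta hq0 hq1]
  have hnorm : ‖2 * Complex.I * (QBern.eta α q : ℂ)‖ = 2 * QBern.eta α q := by
    simp [abs_of_pos hη]
  obtain ⟨R, hR, hA⟩ := QBern.exists_differentiableOn_genFunNumerator hq0 hq1 hα z
  obtain ⟨ρ, hρ, M, hM⟩ := QBern.exists_norm_taylor_sub_le
    (mul_ne_zero (mul_ne_zero two_ne_zero Complex.I_ne_zero) hηC) (hnorm.trans_lt hR) hA
  rw [hnorm] at hρ
  rw [← funext (QBern.genFun_eq_div hq0 hq1 hα z)] at hM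
  -- Only `t²` enters the denominator, so both poles share the same value of the quotient at `j²`.
  have harg : ∀ t : ℂ, t ^ 2 = (2 * Complex.I * (QBern.eta α q : ℂ)) ^ 2 →
      -((((1 - q) * q ^ (-(1 / 4) : ℝ) : ℝ) : ℂ) ^ 2 / 4) * t ^ 2 =
        (QBern.besselZero α q : ℂ) ^ 2 := by
    intro t ht
    rw [ht, hjC]
    linear_combination (-(((1 - q) * q ^ (-(1 / 4) : ℝ) : ℝ) : ℂ) ^ 2 *
      (QBern.eta α q : ℂ) ^ 2) * Complex.I_sq
  simp only [QBern.genFunNumerator, harg _ rfl, harg _ (neg_sq _)] at hM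
  rw [show z * (2 * Complex.I * (QBern.eta α q : ℂ)) =
      Complex.I * (2 * (QBern.eta α q : ℂ) * z) by ring,
    show z * -(2 * Complex.I * (QBern.eta α q : ℂ)) =
      -(Complex.I * (2 * (QBern.eta α q : ℂ) * z)) by ring,
    show -(2 * Complex.I * (QBern.eta α q : ℂ)) / 2 = -(Complex.I * (QBern.eta α q : ℂ)) by ring,
    show - -(2 * Complex.I * (QBern.eta α q : ℂ)) / 2 = Complex.I * (QBern.eta α q : ℂ) by
      ring] at hM
  have hrρ : r < ρ := hr.trans_lt hρ
  have hlo := QBern.isLittleO_mul_of_norm_le_div_pow hr0 hrρ hM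
  constructor
  · refine (hlo (fun n => QBern.qFact q (2 * n)) 0).congr_left fun n => ?_
    simp only [add_zero]
    rw [QBern.principalPart_even hcC hηC hκ, QBern.qBernoulli, QBern.qCos_mul_add_qSin_mul, hD,
      QBern.four_div_scale hq0, hjC]
    ring
  -- The odd index costs only a constant factor `ρ⁻¹`, so the error scale is still `r^(-2n)`.
  · refine (hlo (fun n => QBern.qFact q (2 * n + 1)) 1).congr_left fun n => ?_
    rw [QBern.principalPart_odd hcC hηC hκ, QBern.qBernoulli, QBern.qSin_mul_sub_qCos_mul, hD,
      QBern.four_div_scale hq0, hjC]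
    ring
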